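/- Let $d\ge 1$ and $J\ge 1$ be integers. For $E=\mathbb R^d$, $E=\mathbb R^d\times\mathbb R^d$ or $E=(\mathbb R^d)^J$, let $GMM(E)$ be the set of finite Gaussian mixtures on $E$, i.e. of the probability measures $\sum_{k=1}^K \pi_k g_k$ with $K\ge 1$, $\pi_k\ge 0$, $\sum_k\pi_k=1$ and $g_1,\dots,g_K$ Gaussian measures on $E$ (degenerate covariances allowed). For $\mu,\nu\in GMM(\mathbb R^d)$ put $$MW_2^2(\mu,\nu)=\inf_{\gamma}\int_{\mathbb R^d\times\mathbb R^d}\|y_0-y_1\|^2\,d\gamma(y_0,y_1),$$ where the infimum is over all $\gamma\in GMM(\mathbb R^d\times\mathbb R^d)$ with marginals $\mu$ and $\nu$. Let $\mu_0,\dots,\mu_{J-1}\in GMM(\mathbb R^d)$, and let $\lambda_0,\dots,\lambda_{J-1}\ge 0$ with $\sum_j\lambda_j=1$. For $x=(x_0,\dots,x_{J-1})\in(\mathbb R^d)^J$ let $B(x)=\sum_{j=0}^{J-1}\lambda_j x_j$, and set $$MMW_2^2(\mu_0,\dots,\mu_{J-1})=\inf_{\gamma}\int_{(\mathbb R^d)^J}\sum_{j=0}^{J-1}\lambda_j\|x_j-B(x)\|^2\,d\gamma(x),\qquad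 (\ast)$$ where the infimum is over all $\gamma\in GMM((\mathbb R^d)^J)$ with marginals $\mu_0,\dots,\mu_{J-1}$. Then: 1. the infimum in $(\ast)$ is finite and is attained, i.e. an optimal plan $\gamma^*$ exists; 2. for every optimal plan $\gamma^*$ of $(\ast)$, the push-forward $\nu^*=B\#\gamma^*$ belongs to $GMM(\mathbb R^d)$ and solves the $MW_2$-barycenter problem $$\inf_{\nu\in GMM(\mathbb R^d)}\ \sum_{j=0}^{J-1}\lambda_j\,MW_2^2(\mu_j,\nu);$$ 3. the optimal values coincide: $\displaystyle\inf_{\nu\in GMM(\mathbb R^d)}\sum_{j=0}^{J-1}\lambda_j MW_2^2(\mu_j,\nu)=MMW_2^2(\mu_0,\dots,\mu_{J-1})$. -/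

import Mathlib

open MeasureTheory ProbabilityTheory
open scoped ENNReal NNReal

noncomputable section

namespace GMMOT

/-- The Euclidean space `ℝ^d`. -/
abbrev Eucl (d : ℕ) : Type := EuclideanSpace ℝ (Fin d)

/-- Gaussian mixtures of size `K` on a real topological vector space `E` (used for `ℝ^d`,
`ℝ^d × ℝ^d` and `(ℝ^d)^J`): convex combinations of `K` possibly degenerate Gaussian measures.
Weights may vanish, so a mixture of size `K ≥ 1` is also a mixture of every larger size. -/
def gmmOfSize (E : Type*) [TopologicalSpace E] [AddCommMonoid E] [Module ℝ E]
    [MeasurableSpace E] (K : ℕ) : Set (Measure E) :=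
  {μ | ∃ (p : Fin K → ℝ≥0) (g : Fin K → Measure E),
    ∑ k, p k = 1 ∧ (∀ k, IsGaussian (g k)) ∧ μ = ∑ k, p k • g k}

/-- All finite Gaussian mixtures on `E`. -/
def gmm (E : Type*) [TopologicalSpace E] [AddCommMonoid E] [Module ℝ E]
    [MeasurableSpace E] : Set (Measure E) :=
  ⋃ K : ℕ, gmmOfSize E K

/-- Transport plans between `μ` and `ν`: probability measures on `ℝ^d × ℝ^d` with
marginals `μ` and `ν`. -/
def plans {d : ℕ} (μ ν : Measure (Eucl d)) : Set (Measure (Eucl d × Eucl d)) :=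
  {γ | IsProbabilityMeasure γ ∧ γ.map Prod.fst = μ ∧ γ.map Prod.snd = ν}

/-- The squared mixture Wasserstein distance `MW₂²(μ, ν)`: the infimum of the quadratic cost
over the transport plans that are finite Gaussian mixtures. -/
def MW2sq {d : ℕ} (μ ν : Measure (Eucl d)) : ℝ≥0∞ :=
  ⨅ γ ∈ plans μ ν ∩ gmm (Eucl d × Eucl d), ∫⁻ y, ENNReal.ofReal (‖y.1 - y.2‖ ^ 2) ∂γ

/-- Multi-marginal plans: probability measures on `(ℝ^d)^J` with marginals `μ_0, …, μ_{J-1}`. -/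
def multiPlans {d J : ℕ} (μ : Fin J → Measure (Eucl d)) : Set (Measure (Fin J → Eucl d)) :=
  {γ | IsProbabilityMeasure γ ∧ ∀ j, γ.map (fun x => x j) = μ j}

/-- The barycenter map `B(x) = ∑ j, w j • x j`. -/
def baryMap {d J : ℕ} (w : Fin J → ℝ≥0) (x : Fin J → Eucl d) : Eucl d :=
  ∑ j, (w j : ℝ) • x j

/-- The pointwise multi-marginal cost `c(x) = ∑ j, w j * ‖x j - B(x)‖ ^ 2`. -/
def multiCost {d J : ℕ} (w : Fin J → ℝ≥0) (x : Fin J → Eucl d) : ℝ :=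
  ∑ j, (w j : ℝ) * ‖x j - baryMap w x‖ ^ 2

/-- The total cost `∫ c dγ` of a multi-marginal plan. -/
def planCost {d J : ℕ} (w : Fin J → ℝ≥0) (γ : Measure (Fin J → Eucl d)) : ℝ≥0∞ :=
  ∫⁻ x, ENNReal.ofReal (multiCost w x) ∂γ

/-- Admissible plans of the multi-marginal problem restricted to Gaussian mixtures. -/
def gmmMultiPlans {d J : ℕ} (μ : Fin J → Measure (Eucl d)) : Set (Measure (Fin J → Eucl d)) :=
  multiPlans μ ∩ gmm (Fin J → Eucl d)

/-- The optimal value `MMW₂²(μ_0, …, μ_{J-1})` of the restricted multi-marginal problem. -/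
def MMW2sq {d J : ℕ} (w : Fin J → ℝ≥0) (μ : Fin J → Measure (Eucl d)) : ℝ≥0∞ :=
  ⨅ γ ∈ gmmMultiPlans μ, planCost w γ

/-- `γ` is an optimal plan of the restricted multi-marginal problem. -/
def IsOptimalMultiPlan {d J : ℕ} (w : Fin J → ℝ≥0) (μ : Fin J → Measure (Eucl d))
    (γ : Measure (Fin J → Eucl d)) : Prop :=
  γ ∈ gmmMultiPlans μ ∧ IsMinOn (planCost w) (gmmMultiPlans μ) γ

/-- The barycenter functional `ν ↦ ∑ j, w j * MW₂²(μ_j, ν)`. -/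
def baryObjective {d J : ℕ} (w : Fin J → ℝ≥0) (μ : Fin J → Measure (Eucl d))
    (ν : Measure (Eucl d)) : ℝ≥0∞ :=
  ∑ j, (w j : ℝ≥0∞) * MW2sq (μ j) ν

/-- `ν` solves the `MW₂`-barycenter problem. -/
def IsMW2Barycenter {d J : ℕ} (w : Fin J → ℝ≥0) (μ : Fin J → Measure (Eucl d))
    (ν : Measure (Eucl d)) : Prop :=
  ν ∈ gmm (Eucl d) ∧ IsMinOn (baryObjective w μ) (gmm (Eucl d)) ν

end GMMOT

end

/-!
A Gaussian mixture determines its weights: after projecting to a line that separates the finitely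
many Gaussians involved, the moment generating functions are exponentials of distinct quadratics,
hence linearly independent.

Existence: replacing every Gaussian component of a plan by an optimal Gaussian coupling of its
marginals (Gaussian couplings with fixed marginals form a compact set) lowers the cost, and because
the weights are determined, the marginal conditions become those of a finite transport polytope,
on which the cost is linear.

Barycenters: for an optimal `γ`, the pairs `(x j, B x)` are admissible plans, so `B # γ` costs at
most `∫ c dγ`. Conversely, plans from the `μ j` to a common mixture `ν` can be glued along `ν`: the
weights by a greedy algorithm, the Gaussian components by making the regression residuals on the
common marginal independent. As `B x` minimizes `y ↦ ∑ j, w j * ‖x j - y‖ ^ 2`, the glued plan costs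
at most as much as the given ones.
-/

noncomputable section

namespace GMMOT

/-! ### Identifiability of finite Gaussian mixtures -/

section Identifiability

open Asymptotics Filter

lemma linearIndependent_of_isLittleO {ι α : Type*} [LinearOrder ι] {l : Filter α}
    {f : ι → α → ℝ} (hlt : ∀ i j, i < j → f i =o[l] f j) (hne : ∀ i, ∃ᶠ x in l, f i x ≠ 0) :
    LinearIndependent ℝ f := by
  rw [linearIndependent_iff']
  intro s a hsum
  by_contra! hex
  obtain ⟨m, hm, hmax⟩ := (s.filter fun i => a i ≠ 0).exists_max_image id
    (hex.imp fun i hi => Finset.mem_filter.2 hi)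
  obtain ⟨hms, ham⟩ := Finset.mem_filter.1 hm
  have hrest : (fun x => ∑ i ∈ s.erase m, a i * f i x) =o[l] f m := by
    refine IsLittleO.fun_sum fun i hi => ?_
    obtain ⟨him, his⟩ := Finset.mem_erase.1 hi
    by_cases hai : a i = 0
    · simpa only [hai, zero_mul] using isLittleO_zero (E' := ℝ) (f m) l
    · exact (hlt i m ((hmax i (Finset.mem_filter.2 ⟨his, hai⟩)).lt_of_ne him)).const_mul_left _
  have htop : (fun x => a m * f m x) = fun x => -∑ i ∈ s.erase m, a i * f i x := by
    ext x
    have := congrFun hsum x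
    rw [Finset.sum_apply, ← Finset.add_sum_erase s _ hms] at this
    exact eq_neg_of_add_eq_zero_left this
  exact isLittleO_irrefl (hne m) ((isLittleO_const_mul_left_iff ham).1 (htop ▸ hrest.neg_left))

lemma linearIndependent_exp_quadratic :
    LinearIndependent ℝ fun (p : ℝ ×ₗ ℝ) (x : ℝ) =>
      Real.exp ((ofLex p).2 * x + (ofLex p).1 * x ^ 2 / 2) := by
  refine linearIndependent_of_isLittleO (l := atTop) (fun p q hpq => ?_)
    fun p => (Eventually.of_forall fun x => (Real.exp_pos _).ne').frequently
  rw [Real.isLittleO_exp_comp_exp_comp]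
  have hfactor : (fun x : ℝ => (ofLex q).2 * x + (ofLex q).1 * x ^ 2 / 2 -
      ((ofLex p).2 * x + (ofLex p).1 * x ^ 2 / 2)) = fun x =>
        x * (((ofLex q).2 - (ofLex p).2) + ((ofLex q).1 - (ofLex p).1) / 2 * x) := by
    ext x; ring
  rw [hfactor]
  rcases Prod.Lex.lt_iff.1 hpq with hfst | ⟨hfst, hsnd⟩
  · exact tendsto_id.atTop_mul_atTop₀ (tendsto_atTop_add_const_left _ _
      (tendsto_id.const_mul_atTop (half_pos (sub_pos.2 hfst))))
  · simp only [hfst, sub_self, zero_div, zero_mul, add_zero]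
    exact tendsto_id.atTop_mul_const (sub_pos.2 hsnd)

lemma exists_forall_ne_zero_of_polynomial_on_lines {V ι : Type*} [AddCommGroup V] [Module ℝ V]
    (s : Finset ι) (f : ι → V → ℝ)
    (hpoly : ∀ i u v, ∃ P : Polynomial ℝ, ∀ x : ℝ, f i (u + x • v) = P.eval x)
    (hne : ∀ i ∈ s, ∃ v, f i v ≠ 0) : ∃ v, ∀ i ∈ s, f i v ≠ 0 := by
  classical
  induction s using Finset.induction_on with
  | empty => exact ⟨0, by simp⟩
  | insert j s hj ih =>
    obtain ⟨u, hu⟩ := ih fun i hi => hne i (Finset.mem_insert_of_mem hi)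
    obtain ⟨v, hv⟩ := hne j (Finset.mem_insert_self _ _)
    choose P hP using fun i => hpoly i u (v - u)
    have hP0 : ∀ i ∈ insert j s, P i ≠ 0 := by
      intro i hi h0
      rcases Finset.mem_insert.1 hi with rfl | hi
      · exact hv (by simpa [h0] using hP i 1)
      · exact hu i hi (by simpa [h0] using hP i 0)
    obtain ⟨x, hx⟩ := Polynomial.exists_eval_ne_zero_of_natDegree_lt_card _
      (Finset.prod_ne_zero_iff.2 hP0)
      (by simpa using Cardinal.natCast_lt_aleph0.trans_le (Cardinal.aleph0_le_mk ℝ))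
    rw [Polynomial.eval_prod, Finset.prod_ne_zero_iff] at hx
    exact ⟨u + x • (v - u), fun i hi => by rw [hP]; exact hx i hi⟩

end Identifiability

/-- The Gaussian measures on `E`, the index set of the components of a Gaussian mixture. -/
abbrev GaussianMeasure (E : Type*) [TopologicalSpace E] [AddCommMonoid E] [Module ℝ E]
    [MeasurableSpace E] : Type _ :=
  {g : Measure E // IsGaussian g}

/-- The measure `∑ g, p g • g` with finitely supported weights `p` on the Gaussian measures. The
weights are not normalized. -/
def mixture {E : Type*} [TopologicalSpace E] [AddCommMonoid E] [Module ℝ E]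
    [MeasurableSpace E] : (GaussianMeasure E →₀ ℝ≥0) →ₗ[ℝ≥0] Measure E :=
  Finsupp.linearCombination ℝ≥0 Subtype.val

section Mixture

variable {E : Type*} [TopologicalSpace E] [AddCommMonoid E] [Module ℝ E] [MeasurableSpace E]

instance (g : GaussianMeasure E) : IsGaussian (g : Measure E) := g.2

lemma mixture_apply (p : GaussianMeasure E →₀ ℝ≥0) :
    mixture p = ∑ g ∈ p.support, p g • (g : Measure E) :=
  rfl

lemma lintegral_mixture (p : GaussianMeasure E →₀ ℝ≥0) (f : E → ℝ≥0∞) :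
    ∫⁻ x, f x ∂mixture p = Finsupp.linearCombination ℝ≥0
      (fun g : GaussianMeasure E => ∫⁻ x, f x ∂(g : Measure E)) p := by
  simp_rw [mixture_apply, lintegral_finsetSum_measure, lintegral_smul_measure]
  rfl

lemma integral_mixture (p : GaussianMeasure E →₀ ℝ≥0) {f : E → ℝ}
    (hf : ∀ g : GaussianMeasure E, Integrable f (g : Measure E)) :
    ∫ x, f x ∂mixture p = p.sum fun g a => a • ∫ x, f x ∂(g : Measure E) := by
  rw [mixture_apply, integral_finsetSum_measure fun g _ => (hf g).smul_measure_nnreal]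
  simp_rw [integral_smul_nnreal_measure]
  rfl

lemma mixture_univ (p : GaussianMeasure E →₀ ℝ≥0) :
    mixture p Set.univ = (p.sum fun _ a => a : ℝ≥0) := by
  simpa [Finsupp.linearCombination_apply, Finsupp.sum, ENNReal.smul_def] using lintegral_mixture p 1

lemma mem_gmm_iff {μ : Measure E} : μ ∈ gmm E ↔ IsProbabilityMeasure μ ∧ ∃ p, mixture p = μ := by
  constructor
  · intro hμ
    obtain ⟨K, p, g, hp, hg, rfl⟩ := Set.mem_iUnion.1 hμ
    refine ⟨⟨?_⟩, ∑ k, Finsupp.single ⟨g k, hg k⟩ (p k), ?_⟩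
    · simp only [Measure.finsetSum_apply, Measure.smul_apply, measure_univ, ENNReal.smul_def,
        smul_eq_mul, mul_one]
      exact_mod_cast hp
    · simp [mixture]
  · rintro ⟨hprob, p, rfl⟩
    have hp : ∑ g ∈ p.support, p g = 1 := by
      exact_mod_cast (mixture_univ p).symm.trans measure_univ
    let e := p.support.equivFin.symm
    refine Set.mem_iUnion.2 ⟨p.support.card, fun k => p (e k), fun k => (e k : GaussianMeasure E),
      ?_, fun k => (e k : GaussianMeasure E).2, ?_⟩
    · rw [e.sum_comp fun g => p g, Finset.sum_coe_sort, hp]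
    · rw [e.sum_comp fun g => p g • ((g : GaussianMeasure E) : Measure E), mixture_apply,
        ← Finset.sum_coe_sort]

end Mixture

section Map

variable {E F : Type*} [NormedAddCommGroup E] [NormedSpace ℝ E] [MeasurableSpace E] [BorelSpace E]
  [NormedAddCommGroup F] [NormedSpace ℝ F] [MeasurableSpace F] [BorelSpace F]

/-- The push-forward of a Gaussian measure under a continuous linear map, as a Gaussian measure. -/
def GaussianMeasure.map (L : E →L[ℝ] F) (g : GaussianMeasure E) : GaussianMeasure F :=
  ⟨(g : Measure E).map L, inferInstance⟩

lemma mixture_mapDomain_map (L : E →L[ℝ] F) (p : GaussianMeasure E →₀ ℝ≥0) :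
    mixture (p.mapDomain (GaussianMeasure.map L)) = (mixture p).map L := by
  rw [mixture_apply p, Measure.map_finset_sum (by fun_prop), mixture,
    Finsupp.linearCombination_mapDomain]
  simp_rw [Measure.map_smul]
  rfl

lemma map_mem_gmm {μ : Measure E} (hμ : μ ∈ gmm E) (L : E →L[ℝ] F) : μ.map L ∈ gmm F := by
  obtain ⟨hprob, p, rfl⟩ := mem_gmm_iff.1 hμ
  exact mem_gmm_iff.2 ⟨Measure.isProbabilityMeasure_map (by fun_prop), _, mixture_mapDomain_map L p⟩

end Map

section Injectivity

variable {E : Type*} [NormedAddCommGroup E] [NormedSpace ℝ E] [MeasurableSpace E]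

lemma mgf_dual_of_isGaussian (μ : Measure E) [IsGaussian μ] (L : StrongDual ℝ E) :
    mgf L μ = fun x => Real.exp (μ[L] * x + Var[L; μ] * x ^ 2 / 2) := by
  ext x
  rw [mgf_gaussianReal (IsGaussian.map_eq_gaussianReal L),
    Real.coe_toNNReal _ (variance_nonneg _ _)]

lemma cgf_dual_one_of_isGaussian (μ : Measure E) [IsGaussian μ] (L : StrongDual ℝ E) :
    cgf L μ 1 = μ[L] + Var[L; μ] / 2 := by
  simp [cgf, mgf_dual_of_isGaussian]

lemma integrable_exp_mul_dual_of_isGaussian (μ : Measure E) [IsGaussian μ] (L : StrongDual ℝ E)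
    (x : ℝ) : Integrable (fun y => Real.exp (x * L y)) μ := by
  refine Integrable.of_integral_ne_zero ?_
  change mgf L μ x ≠ 0
  rw [mgf_dual_of_isGaussian]
  exact (Real.exp_pos _).ne'

lemma mgf_dual_mixture (p : GaussianMeasure E →₀ ℝ≥0) (L : StrongDual ℝ E) :
    mgf L (mixture p) =
      Finsupp.linearCombination ℝ≥0 (fun g : GaussianMeasure E => mgf L (g : Measure E)) p := by
  ext x
  rw [mgf, integral_mixture p fun g => integrable_exp_mul_dual_of_isGaussian g L x]
  simp [Finsupp.linearCombination_apply, Finsupp.sum, mgf]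

lemma mixture_injective_real : Function.Injective (mixture (E := ℝ)) := by
  let L : StrongDual ℝ ℝ := .id ℝ ℝ
  have hparam : Function.Injective fun g : GaussianMeasure ℝ =>
      toLex (Var[L; (g : Measure ℝ)], (g : Measure ℝ)[L]) := by
    intro g h hgh
    obtain ⟨hvar, hmean⟩ := Prod.mk.inj (toLex.injective hgh)
    have hmap : (g : Measure ℝ).map L = (h : Measure ℝ).map L := by
      rw [IsGaussian.map_eq_gaussianReal, IsGaussian.map_eq_gaussianReal, hvar, hmean]
    exact Subtype.ext (by simpa [L] using hmap)
  have hmgf : LinearIndependent ℝ≥0 fun g : GaussianMeasure ℝ => mgf L (g : Measure ℝ) := by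
    simp_rw [mgf_dual_of_isGaussian]
    exact (linearIndependent_exp_quadratic.comp _ hparam).restrict_scalars
      (by simpa [NNReal.smul_def] using NNReal.coe_injective)
  intro p q hpq
  exact hmgf (by rw [← mgf_dual_mixture, ← mgf_dual_mixture, hpq])

variable [BorelSpace E] [CompleteSpace E] [SecondCountableTopology E]

lemma eq_of_cgf_dual_one_eq {μ ν : Measure E} [IsGaussian μ] [IsGaussian ν]
    (h : ∀ L : StrongDual ℝ E, cgf L μ 1 = cgf L ν 1) : μ = ν := by
  refine Measure.ext_of_charFunDual (funext fun L => ?_)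
  have hplus := h L
  have hminus := h (-L)
  simp only [cgf_dual_one_of_isGaussian] at hplus hminus
  simp only [FunLike.coe_neg, Pi.neg_apply, variance_neg, integral_neg] at hminus
  have hmean : μ[L] = ν[L] := by linarith
  have hvar : Var[L; μ] = Var[L; ν] := by linarith
  rw [IsGaussian.charFunDual_eq, IsGaussian.charFunDual_eq, hvar,
    integral_complex_ofReal, integral_complex_ofReal, hmean]

lemma exists_polynomial_cgf_dual_one (μ : Measure E) [IsGaussian μ] (L M : StrongDual ℝ E) :
    ∃ P : Polynomial ℝ, ∀ x : ℝ, cgf ⇑(L + x • M) μ 1 = P.eval x := by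
  have hquad : ∀ N : StrongDual ℝ E, cgf N μ 1 =
      N (∫ y, y ∂μ) + covarianceBilinDual μ N N / 2 := fun N => by
    rw [cgf_dual_one_of_isGaussian, IsGaussian.integral_dual,
      covarianceBilinDual_self_eq_variance IsGaussian.memLp_two_id]
  refine ⟨.C (L (∫ y, y ∂μ) + covarianceBilinDual μ L L / 2) +
    .C (M (∫ y, y ∂μ) + (covarianceBilinDual μ L M + covarianceBilinDual μ M L) / 2) * .X +
    .C (covarianceBilinDual μ M M / 2) * .X ^ 2, fun x => ?_⟩
  rw [hquad]
  simp
  ring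

lemma exists_dual_injOn_map (s : Finset (GaussianMeasure E)) :
    ∃ L : StrongDual ℝ E, Set.InjOn (GaussianMeasure.map L) s := by
  classical
  let f : GaussianMeasure E × GaussianMeasure E → StrongDual ℝ E → ℝ := fun p L =>
    cgf L (p.1 : Measure E) 1 - cgf L (p.2 : Measure E) 1
  obtain ⟨L, hL⟩ := exists_forall_ne_zero_of_polynomial_on_lines
    ((s ×ˢ s).filter fun p => p.1 ≠ p.2) f
    (fun p L M => by
      obtain ⟨P, hP⟩ := exists_polynomial_cgf_dual_one (p.1 : Measure E) L M
      obtain ⟨Q, hQ⟩ := exists_polynomial_cgf_dual_one (p.2 : Measure E) L M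
      exact ⟨P - Q, fun x => by simp only [f, hP, hQ, Polynomial.eval_sub]⟩)
    (fun p hp => by
      by_contra! h0
      exact (Finset.mem_filter.1 hp).2
        (Subtype.ext (eq_of_cgf_dual_one_eq fun L => sub_eq_zero.1 (h0 L))))
  refine ⟨L, fun g hg h hh hgh => ?_⟩
  by_contra hne
  refine hL (g, h) (by simpa [hne] using ⟨hg, hh⟩) (sub_eq_zero.2 ?_)
  have hmap : (g : Measure E).map L = (h : Measure E).map L := congrArg Subtype.val hgh
  simp only [cgf]
  rw [← mgf_id_map (by fun_prop), hmap, mgf_id_map (by fun_prop)]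

theorem mixture_injective : Function.Injective (mixture (E := E)) := by
  classical
  intro p q hpq
  obtain ⟨L, hL⟩ := exists_dual_injOn_map (p.support ∪ q.support)
  refine Finsupp.mapDomain_injOn _ hL (by simp) (by simp) (mixture_injective_real ?_)
  rw [mixture_mapDomain_map, mixture_mapDomain_map, hpq]

end Injectivity

/-! ### Optimal Gaussian couplings of Gaussian measures -/

section Compactness

open Filter Topology

lemma isTightMeasureSet_of_map_eval {ι : Type*} [Finite ι] {X : ι → Type*}
    [∀ i, TopologicalSpace (X i)] [∀ i, MeasurableSpace (X i)] {S : Set (Measure (∀ i, X i))}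
    (hS : ∀ i, IsTightMeasureSet (Measure.map (fun x => x i) '' S)) : IsTightMeasureSet S := by
  have := Fintype.ofFinite ι
  simp_rw [isTightMeasureSet_iff_exists_isCompact_measure_compl_le, Set.forall_mem_image] at hS ⊢
  intro ε hε
  choose K hK hKε using fun i =>
    hS i (ε / Fintype.card ι) (ENNReal.div_pos hε.ne' (ENNReal.natCast_ne_top _))
  refine ⟨Set.univ.pi K, isCompact_univ_pi hK, fun μ hμ => ?_⟩
  have hcompl : (Set.univ.pi K)ᶜ ⊆ ⋃ i, (fun x : ∀ i, X i => x i) ⁻¹' (K i)ᶜ := by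
    intro x hx
    simpa [Set.mem_pi] using hx
  calc μ (Set.univ.pi K)ᶜ
    _ ≤ ∑ i, μ ((fun x : ∀ i, X i => x i) ⁻¹' (K i)ᶜ) :=
      (measure_mono hcompl).trans (measure_iUnion_fintype_le _ _)
    _ ≤ ∑ _i : ι, ε / Fintype.card ι := Finset.sum_le_sum fun i _ =>
      (Measure.le_map_apply (measurable_pi_apply i).aemeasurable _).trans (hKε i hμ)
    _ ≤ ε := by
      rw [Finset.sum_const, Finset.card_univ, nsmul_eq_mul]
      exact ENNReal.mul_div_le

lemma lowerSemicontinuous_lintegral {Ω : Type*} [MeasurableSpace Ω] [TopologicalSpace Ω]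
    [OpensMeasurableSpace Ω] {c : Ω → ℝ≥0∞} (hc : Continuous c) :
    LowerSemicontinuous fun γ : ProbabilityMeasure Ω => ∫⁻ x, c x ∂(γ : Measure Ω) := by
  have hfin : ∀ (n : ℕ) x, min (c x) n ≠ ∞ := fun n x =>
    ne_top_of_le_ne_top (ENNReal.natCast_ne_top n) (min_le_right _ _)
  let f (n : ℕ) : BoundedContinuousFunction Ω ℝ≥0 :=
    BoundedContinuousFunction.mkOfBound
      ⟨fun x => (min (c x) n).toNNReal,
        ENNReal.continuousOn_toNNReal.comp_continuous (by fun_prop) (hfin n)⟩ n fun x y => by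
      have hle : ∀ x, (min (c x) n).toNNReal ≤ n := fun x =>
        (ENNReal.toNNReal_mono (ENNReal.natCast_ne_top n) (min_le_right _ _)).trans_eq
          (ENNReal.toNNReal_natCast n)
      rw [NNReal.dist_eq, abs_sub_le_iff]
      exact ⟨sub_le_iff_le_add.2 (by exact_mod_cast le_add_right (hle x)),
        sub_le_iff_le_add.2 (by exact_mod_cast le_add_right (hle y))⟩
  have hcoe : ∀ n x, (f n x : ℝ≥0∞) = min (c x) n := fun n x =>
    ENNReal.coe_toNNReal (hfin n x)
  have hsup : ∀ x, c x = ⨆ n, (f n x : ℝ≥0∞) := by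
    intro x
    simp_rw [hcoe]
    rw [← inf_iSup_eq, ENNReal.iSup_natCast, inf_top_eq]
  have hmono : Monotone fun n x => (f n x : ℝ≥0∞) := by
    intro m n hmn x
    simp only [hcoe]
    gcongr
  simp_rw [fun γ : ProbabilityMeasure Ω => (lintegral_congr hsup).trans
    (lintegral_iSup (μ := (γ : Measure Ω)) (fun n => by fun_prop) hmono)]
  exact lowerSemicontinuous_iSup fun n =>
    (ProbabilityMeasure.continuous_lintegral_boundedContinuousFunction (f n)).lowerSemicontinuous

lemma isClosed_setOf_eq_gaussianReal (m : ℝ) :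
    IsClosed {μ : ProbabilityMeasure ℝ | ∃ v, (μ : Measure ℝ) = gaussianReal m v} := by
  refine IsSeqClosed.isClosed fun μ μ₀ hμ htendsto => ?_
  choose v hv using hμ
  have hchar := ProbabilityMeasure.tendsto_iff_tendsto_charFun.1 htendsto
  simp only [hv, charFun_gaussianReal] at hchar
  obtain ⟨t, ht, ht₀⟩ : ∃ t : ℝ, charFun (μ₀ : Measure ℝ) t ≠ 0 ∧ t ≠ 0 := by
    have hne : ∀ᶠ t in 𝓝 (0 : ℝ), charFun (μ₀ : Measure ℝ) t ≠ 0 :=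
      continuous_charFun.continuousAt.eventually_ne (by simp)
    exact ((hne.filter_mono nhdsWithin_le_nhds).and self_mem_nhdsWithin :
      ∀ᶠ t in 𝓝[≠] (0 : ℝ), _ ∧ t ≠ 0).exists
  have hlog : Tendsto (fun n => (v n : ℝ)) atTop
      (𝓝 (-2 * Real.log ‖charFun (μ₀ : Measure ℝ) t‖ / t ^ 2)) := by
    have := (((hchar t).norm.log (norm_ne_zero_iff.2 ht)).const_mul (-2)).div_const (t ^ 2)
    refine this.congr fun n => ?_
    rw [Complex.norm_exp, Real.log_exp]
    simp [← Complex.ofReal_pow]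
    field_simp
  obtain ⟨v₀, hv₀⟩ : ∃ v₀ : ℝ≥0, Tendsto (fun n => (v n : ℝ)) atTop (𝓝 v₀) :=
    ⟨⟨_, ge_of_tendsto' hlog fun n => (v n).2⟩, hlog⟩
  refine ⟨v₀, Measure.ext_of_charFun (funext fun s => tendsto_nhds_unique (hchar s) ?_)⟩
  rw [charFun_gaussianReal]
  have hcont : Continuous fun r : ℝ => Complex.exp (s * m * Complex.I - r * s ^ 2 / 2) := by
    fun_prop
  exact (hcont.tendsto _).comp hv₀

end Compactness

section Coupling

variable {ι : Type*} {E : ι → Type*} [∀ j, NormedAddCommGroup (E j)]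
  [∀ j, NormedSpace ℝ (E j)] [∀ j, MeasurableSpace (E j)] [∀ j, BorelSpace (E j)]
  [∀ j, SecondCountableTopology (E j)]

/-- The Gaussian measures on a product space with prescribed marginals. -/
def gaussianCouplings (g : ∀ j, GaussianMeasure (E j)) : Set (ProbabilityMeasure (∀ j, E j)) :=
  {γ | IsGaussian (γ : Measure (∀ j, E j)) ∧
    ∀ j, (γ : Measure (∀ j, E j)).map (ContinuousLinearMap.proj (R := ℝ) j) = g j}

variable (g : ∀ j, GaussianMeasure (E j))

/-- Since the means of the one-dimensional projections are prescribed, closedness only involves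
limits of the variances. -/
lemma gaussianCouplings_eq [Fintype ι] [DecidableEq ι] : gaussianCouplings g =
    (⋂ j, {γ : ProbabilityMeasure (∀ j, E j) |
      (γ : Measure (∀ j, E j)).map (ContinuousLinearMap.proj (R := ℝ) j) = g j}) ∩
    ⋂ L : StrongDual ℝ (∀ j, E j), {γ | ∃ v, (γ : Measure (∀ j, E j)).map L =
      gaussianReal (∑ j, ∫ x, L (Pi.single j x) ∂(g j : Measure (E j))) v} := by
  ext γ
  simp only [gaussianCouplings, Set.mem_inter_iff, Set.mem_iInter, Set.mem_ofPred_eq]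
  refine ⟨fun ⟨hγ, hmarg⟩ => ⟨hmarg, fun L => ⟨Var[L; γ].toNNReal, ?_⟩⟩, fun ⟨hmarg, hL⟩ =>
    ⟨isGaussian_of_map_eq_gaussianReal fun L => ⟨_, hL L⟩, hmarg⟩⟩
  rw [IsGaussian.map_eq_gaussianReal L]
  congr 1
  have hL : ∀ x, L x = ∑ j, L (Pi.single j (x j)) := fun x => by
    rw [← map_sum, Finset.univ_sum_single]
  rw [integral_congr_ae (.of_forall hL), integral_finsetSum _ fun j _ => ?_]
  · refine Finset.sum_congr rfl fun j _ => ?_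
    rw [← hmarg j, integral_map (by fun_prop) (by fun_prop)]
    rfl
  · exact IsGaussian.integrable_dual _
      (L ∘L ContinuousLinearMap.single ℝ E j ∘L ContinuousLinearMap.proj j)

variable [∀ j, CompleteSpace (E j)]

instance isGaussian_pi [Fintype ι] (ρ : ∀ j, Measure (E j)) [hρ : ∀ j, IsGaussian (ρ j)] :
    IsGaussian (Measure.pi ρ) := by
  have hlaw : ∀ j, HasGaussianLaw (fun x : ∀ j, E j => x j) (Measure.pi ρ) := fun j =>
    ⟨(measurePreserving_eval ρ j).map_eq ▸ hρ j⟩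
  have hindep : iIndepFun (fun j (x : ∀ j, E j) => x j) (Measure.pi ρ) :=
    iIndepFun_pi fun _ => aemeasurable_id
  simpa using (hindep.hasGaussianLaw hlaw).isGaussian_map

lemma gaussianCouplings_nonempty [Finite ι] : (gaussianCouplings g).Nonempty := by
  cases nonempty_fintype ι
  exact ⟨⟨Measure.pi fun j => (g j : Measure (E j)), inferInstance⟩, isGaussian_pi _,
    fun j => (measurePreserving_eval _ j).map_eq⟩

lemma isCompact_gaussianCouplings [Finite ι] : IsCompact (gaussianCouplings g) := by
  cases nonempty_fintype ι
  classical
  have htight : IsTightMeasureSet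
      {(γ : Measure (∀ j, E j)) | γ ∈ gaussianCouplings g} := by
    refine isTightMeasureSet_of_map_eval fun j => ?_
    refine (isTightMeasureSet_singleton (μ := (g j : Measure (E j)))).subset ?_
    rintro _ ⟨_, ⟨γ, hγ, rfl⟩, rfl⟩
    exact hγ.2 j
  have hclosed : IsClosed (gaussianCouplings g) := by
    rw [gaussianCouplings_eq]
    refine .inter (isClosed_iInter fun j => ?_) (isClosed_iInter fun L => ?_)
    · let gj : ProbabilityMeasure (E j) := ⟨g j, inferInstance⟩
      have hmap := ProbabilityMeasure.continuous_map
        (ContinuousLinearMap.proj (R := ℝ) (φ := E) j).continuous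
      convert isClosed_eq hmap (continuous_const (y := gj)) using 3 with γ
      exact ProbabilityMeasure.toMeasure_injective.eq_iff (a := γ.map _) (b := gj)
    · exact (isClosed_setOf_eq_gaussianReal _).preimage
        (ProbabilityMeasure.continuous_map L.continuous)
  simpa [hclosed.closure_eq] using isCompact_closure_of_isTightMeasureSet htight

theorem exists_isMinOn_lintegral_gaussianCouplings [Finite ι] {c : (∀ j, E j) → ℝ≥0∞}
    (hc : Continuous c) :
    ∃ γ ∈ gaussianCouplings g, IsMinOn (fun γ : ProbabilityMeasure (∀ j, E j) =>
      ∫⁻ x, c x ∂(γ : Measure (∀ j, E j))) (gaussianCouplings g) γ :=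
  ((lowerSemicontinuous_lintegral hc).lowerSemicontinuousOn _).exists_isMinOn
    (gaussianCouplings_nonempty g) (isCompact_gaussianCouplings g)

end Coupling

/-! ### Optimal Gaussian mixture couplings -/

section DiscreteTransport

lemma lowerSemicontinuous_smul_ennreal (c : ℝ≥0∞) : LowerSemicontinuous fun t : ℝ≥0 => t • c := by
  have hsup : ∀ t : ℝ≥0, t • c = ⨆ n : ℕ, (t : ℝ≥0∞) * min c n := fun t => by
    rw [← ENNReal.mul_iSup, ← inf_iSup_eq, ENNReal.iSup_natCast, inf_top_eq]
    rfl
  simp_rw [hsup]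
  refine lowerSemicontinuous_iSup fun n => Continuous.lowerSemicontinuous ?_
  have hfin : min c n ≠ ∞ := ne_top_of_le_ne_top (ENNReal.natCast_ne_top n) (min_le_right _ _)
  exact (ENNReal.continuous_mul_const hfin).comp ENNReal.continuous_coe

lemma le_mapDomain_apply {α β : Type*} (f : α → β) (q : α →₀ ℝ≥0) (a : α) :
    q a ≤ q.mapDomain f (f a) := by
  classical
  rw [Finsupp.mapDomain_apply_eq_sum]
  by_cases ha : a ∈ q.support
  · exact Finset.single_le_sum (fun _ _ => zero_le) (Finset.mem_filter.2 ⟨ha, rfl⟩)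
  · simp [Finsupp.notMem_support_iff.1 ha]

variable {ι : Type*} {A : ι → Type*}

/-- Finitely supported weights on a product of index sets with prescribed marginals: the
multi-marginal transport polytope. -/
def transportPolytope (p : ∀ j, A j →₀ ℝ≥0) : Set ((∀ j, A j) →₀ ℝ≥0) :=
  {q | ∀ j, q.mapDomain (fun a => a j) = p j}

variable {p : ∀ j, A j →₀ ℝ≥0} {q : (∀ j, A j) →₀ ℝ≥0}

lemma apply_le_of_mem_transportPolytope (hq : q ∈ transportPolytope p) (a : ∀ j, A j) (j : ι) :
    q a ≤ p j (a j) :=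
  hq j ▸ le_mapDomain_apply _ q a

lemma isCompact_preimage_transportPolytope [Nonempty ι] (p : ∀ j, A j →₀ ℝ≥0)
    (S : Finset (∀ j, A j)) :
    IsCompact ((fun f : S → ℝ≥0 => ∑ s : S, Finsupp.single s.1 (f s)) ⁻¹' transportPolytope p) := by
  classical
  set Φ : (S → ℝ≥0) → (∀ j, A j) →₀ ℝ≥0 := fun f => ∑ s : S, Finsupp.single s.1 (f s)
  have hclosed : IsClosed (Φ ⁻¹' transportPolytope p) := by
    have hset : Φ ⁻¹' transportPolytope p =
        ⋂ (j) (b), {f | ∑ s : S, (if s.1 j = b then f s else 0) = p j b} := by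
      ext f
      simp [Φ, transportPolytope, Finsupp.ext_iff, Finsupp.mapDomain_finsetSum,
        Finsupp.mapDomain_single, Finsupp.single_apply]
    rw [hset]
    refine isClosed_iInter fun j => isClosed_iInter fun b => isClosed_eq ?_ continuous_const
    exact continuous_finsetSum _ fun s _ => by split_ifs <;> fun_prop
  obtain ⟨j⟩ := ‹Nonempty ι›
  refine (isCompact_univ_pi fun s : S => isCompact_Icc (a := 0) (b := p j (s.1 j)))
    |>.of_isClosed_subset hclosed fun f hf s _ => ⟨zero_le, ?_⟩
  have happly : Φ f s = f s := by simp [Φ, Finsupp.single_apply]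
  exact happly.symm.trans_le (apply_le_of_mem_transportPolytope hf s j)

theorem exists_isMinOn_transportPolytope [Finite ι] [Nonempty ι]
    (hp : (transportPolytope p).Nonempty) (c : (∀ j, A j) → ℝ≥0∞) :
    ∃ q ∈ transportPolytope p,
      IsMinOn (Finsupp.linearCombination ℝ≥0 c) (transportPolytope p) q := by
  have := Fintype.ofFinite ι
  classical
  let S : Finset (∀ j, A j) := Fintype.piFinset fun j => (p j).support
  let Φ (f : S → ℝ≥0) : (∀ j, A j) →₀ ℝ≥0 := ∑ s : S, Finsupp.single s.1 (f s)
  have hΦ : ∀ q ∈ transportPolytope p, Φ (fun s => q s) = q := fun q hq => by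
    have hsupp : q.support ⊆ S := fun a ha => Fintype.mem_piFinset.2 fun j =>
      Finsupp.mem_support_iff.2 (ne_bot_of_le_ne_bot (Finsupp.mem_support_iff.1 ha)
        (apply_le_of_mem_transportPolytope hq a j))
    conv_rhs => rw [← q.sum_single, Finsupp.sum_of_support_subset q hsupp _ (by simp)]
    exact Finset.sum_coe_sort S fun a => Finsupp.single a (q a)
  have hlsc : LowerSemicontinuous fun f => Finsupp.linearCombination ℝ≥0 c (Φ f) := by
    simp only [Φ, map_sum, Finsupp.linearCombination_single]
    exact lowerSemicontinuous_sum fun s _ =>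
      (lowerSemicontinuous_smul_ennreal (c s)).comp (continuous_apply s)
  obtain ⟨q₀, hq₀⟩ := hp
  obtain ⟨f, hf, hmin⟩ := (hlsc.lowerSemicontinuousOn _).exists_isMinOn
    ⟨_, Set.mem_preimage.2 ((hΦ q₀ hq₀).symm ▸ hq₀)⟩ (isCompact_preimage_transportPolytope p S)
  exact ⟨Φ f, hf, fun q hq => hΦ q hq ▸ hmin ((hΦ q hq).symm ▸ hq : Φ _ ∈ _)⟩

end DiscreteTransport

section OptimalMixture

variable {ι : Type*} {E : ι → Type*} [∀ j, NormedAddCommGroup (E j)]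
  [∀ j, NormedSpace ℝ (E j)] [∀ j, MeasurableSpace (E j)] [∀ j, BorelSpace (E j)]
  [∀ j, SecondCountableTopology (E j)]

/-- The Gaussian marginals of a Gaussian measure on a product space. -/
def GaussianMeasure.marginals [Fintype ι] (γ : GaussianMeasure (∀ j, E j)) (j : ι) :
    GaussianMeasure (E j) :=
  γ.map (ContinuousLinearMap.proj j)

lemma mixture_mapDomain_marginals [Fintype ι] (r : GaussianMeasure (∀ j, E j) →₀ ℝ≥0)
    (j : ι) :
    mixture ((r.mapDomain GaussianMeasure.marginals).mapDomain fun g => g j) =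
      (mixture r).map fun x => x j := by
  rw [← Finsupp.mapDomain_comp]
  exact mixture_mapDomain_map (ContinuousLinearMap.proj (R := ℝ) (φ := E) j) r

variable [∀ j, CompleteSpace (E j)]

lemma mapDomain_marginals_mem_transportPolytope_iff [Fintype ι]
    {p : ∀ j, GaussianMeasure (E j) →₀ ℝ≥0} {r : GaussianMeasure (∀ j, E j) →₀ ℝ≥0} :
    r.mapDomain GaussianMeasure.marginals ∈ transportPolytope p ↔
      ∀ j, (mixture r).map (fun x => x j) = mixture (p j) :=
  forall_congr' fun j => by rw [← mixture_mapDomain_marginals, mixture_injective.eq_iff]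

lemma exists_marginals_eq_and_lintegral_le [Fintype ι] {c : (∀ j, E j) → ℝ≥0∞} (hc : Continuous c) :
    ∃ G : (∀ j, GaussianMeasure (E j)) → GaussianMeasure (∀ j, E j),
      (∀ g, (G g).marginals = g) ∧
      ∀ γ : GaussianMeasure (∀ j, E j),
        ∫⁻ x, c x ∂(G γ.marginals : Measure (∀ j, E j)) ≤ ∫⁻ x, c x ∂(γ : Measure (∀ j, E j)) := by
  choose G hG hmin using fun g : ∀ j, GaussianMeasure (E j) =>
    exists_isMinOn_lintegral_gaussianCouplings g hc
  refine ⟨fun g => ⟨G g, (hG g).1⟩, fun g => funext fun j => Subtype.ext ((hG g).2 j), fun γ => ?_⟩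
  exact hmin γ.marginals (a := ⟨γ, inferInstance⟩) ⟨γ.2, fun j => rfl⟩

/-- The finite Gaussian mixtures on a product space with prescribed marginals. -/
def gmmCouplings (μ : ∀ j, Measure (E j)) : Set (Measure (∀ j, E j)) :=
  {γ ∈ gmm (∀ j, E j) | ∀ j, γ.map (fun x => x j) = μ j}

theorem exists_isMinOn_lintegral_gmmCouplings [Finite ι] [Nonempty ι]
    {μ : ∀ j, Measure (E j)} (hμ : (gmmCouplings μ).Nonempty) {c : (∀ j, E j) → ℝ≥0∞}
    (hc : Continuous c) :
    ∃ γ ∈ gmmCouplings μ, IsMinOn (fun γ => ∫⁻ x, c x ∂γ) (gmmCouplings μ) γ := by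
  cases nonempty_fintype ι
  obtain ⟨γ₀, hγ₀, hγ₀μ⟩ := hμ
  have hμ : ∀ j, μ j ∈ gmm (E j) := fun j =>
    hγ₀μ j ▸ map_mem_gmm hγ₀ (ContinuousLinearMap.proj (R := ℝ) (φ := E) j)
  choose hprob p hp using fun j => mem_gmm_iff.1 (hμ j)
  have hplan : ∀ r, (∀ j, (mixture r).map (fun x => x j) = μ j) ↔
      r.mapDomain GaussianMeasure.marginals ∈ transportPolytope p := fun r => by
    simp_rw [mapDomain_marginals_mem_transportPolytope_iff, hp]
  obtain ⟨r₀, rfl⟩ := (mem_gmm_iff.1 hγ₀).2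
  obtain ⟨G, hG, hGc⟩ := exists_marginals_eq_and_lintegral_le hc
  obtain ⟨q, hq, hmin⟩ := exists_isMinOn_transportPolytope ⟨_, (hplan r₀).1 hγ₀μ⟩
    fun g => ∫⁻ x, c x ∂(G g : Measure (∀ j, E j))
  have hGq : ∀ j, (mixture (q.mapDomain G)).map (fun x => x j) = μ j := by
    rw [hplan, ← Finsupp.mapDomain_comp, show GaussianMeasure.marginals ∘ G = id from funext hG,
      Finsupp.mapDomain_id]
    exact hq
  obtain ⟨j⟩ := ‹Nonempty ι›
  have hGq_prob : IsProbabilityMeasure (mixture (q.mapDomain G)) :=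
    (Measure.isProbabilityMeasure_map_iff (measurable_pi_apply j).aemeasurable).1
      (hGq j ▸ hprob j)
  refine ⟨_, ⟨mem_gmm_iff.2 ⟨hGq_prob, _, rfl⟩, hGq⟩, fun γ ⟨hγ, hγμ⟩ => ?_⟩
  obtain ⟨-, r, rfl⟩ := mem_gmm_iff.1 hγ
  simp only [Set.mem_ofPred_eq, lintegral_mixture, Finsupp.linearCombination_mapDomain]
  refine (hmin ((hplan r).1 hγμ)).trans ?_
  rw [Finsupp.linearCombination_mapDomain]
  exact Finset.sum_le_sum fun γ _ => smul_le_smul_of_nonneg_left (hGc γ) zero_le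

end OptimalMixture

/-! ### Gluing along a common marginal -/

section Regression

lemma exists_sub_orthogonal_of_isPosSemidef {V W : Type*} [AddCommGroup V] [Module ℝ V]
    [AddCommGroup W] [Module ℝ W] [FiniteDimensional ℝ W] {B : LinearMap.BilinForm ℝ V}
    (hB : B.IsPosSemidef) (f : W →ₗ[ℝ] V) (v : V) : ∃ w, ∀ w', B (v - f w) (f w') = 0 := by
  let S : W →ₗ[ℝ] Module.Dual ℝ W := B.compl₁₂ f f
  have hker : B v ∘ₗ f ∈ (LinearMap.ker S).dualAnnihilator := by
    rw [Submodule.mem_dualAnnihilator]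
    intro w hw
    have hw₀ : B (f w) (f w) = 0 := LinearMap.congr_fun (LinearMap.mem_ker.1 hw) w
    rw [B.apply_apply_same_eq_zero_iff hB.nonneg ⟨hB.isSymm.eq⟩, LinearMap.mem_ker] at hw₀
    simpa [hw₀] using hB.isSymm.eq v (f w)
  rw [← LinearMap.range_dualMap_eq_dualAnnihilator_ker] at hker
  obtain ⟨φ, hφ⟩ := hker
  obtain ⟨w, rfl⟩ := (Module.evalEquiv ℝ W).surjective φ
  refine ⟨w, fun w' => ?_⟩
  have hw' : B (f w') (f w) = B v (f w') := LinearMap.congr_fun hφ w'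
  rw [map_sub, LinearMap.sub_apply, ← hw', sub_eq_zero]
  exact hB.isSymm.eq _ _

variable {E F : Type*} [NormedAddCommGroup E] [NormedSpace ℝ E] [FiniteDimensional ℝ E]
  [MeasurableSpace E] [BorelSpace E]
  [NormedAddCommGroup F] [NormedSpace ℝ F] [FiniteDimensional ℝ F]
  [MeasurableSpace F] [BorelSpace F]

lemma exists_covariance_sub_clm_eq_zero {h : Measure (E × F)} [IsFiniteMeasure h]
    (hmem : MemLp id 2 h) :
    ∃ R : F →L[ℝ] E, ∀ (L : StrongDual ℝ E) (M : StrongDual ℝ F),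
      cov[fun z : E × F => L (z.1 - R z.2), fun z => M z.2; h] = 0 := by
  have := FiniteDimensional.complete ℝ E
  have := FiniteDimensional.complete ℝ F
  let fstDual : StrongDual ℝ E →ₗ[ℝ] StrongDual ℝ (E × F) :=
    (ContinuousLinearMap.precomp ℝ (ContinuousLinearMap.fst ℝ E F)).toLinearMap
  let sndDual : StrongDual ℝ F →ₗ[ℝ] StrongDual ℝ (E × F) :=
    (ContinuousLinearMap.precomp ℝ (ContinuousLinearMap.snd ℝ E F)).toLinearMap
  let b := Module.finBasis ℝ E
  let coord (i) : StrongDual ℝ E := (b.coord i).toContinuousLinearMap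
  choose T hT using fun i => exists_sub_orthogonal_of_isPosSemidef
    (isPosSemidef_covarianceBilinDual (μ := h)) sndDual (fstDual (coord i))
  refine ⟨∑ i, (T i).smulRight (b i), fun L M => ?_⟩
  have hsub : (fun z : E × F => L (z.1 - (∑ i, (T i).smulRight (b i)) z.2)) =
      ∑ i, L (b i) • (fstDual (coord i) - sndDual (T i)) := by
    ext z
    have hz : L z.1 = ∑ i, L (b i) * b.repr z.1 i := by
      conv_lhs => rw [← b.sum_repr z.1]
      simp only [map_sum, map_smul, smul_eq_mul, mul_comm]
    simp [hz, coord, fstDual, sndDual, mul_sub, mul_comm]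
  rw [hsub]
  change cov[_, sndDual M; h] = 0
  rw [← covarianceBilinDual_eq_covariance hmem]
  have horth (i) : covarianceBilinDual h (fstDual (coord i) - sndDual (T i)) (sndDual M) = 0 :=
    hT i M
  simp only [map_sum, map_smul, _root_.sum_apply, _root_.smul_apply, horth, smul_zero,
    Finset.sum_const_zero]

lemma exists_eq_map_prod_of_isGaussian (h : Measure (E × F)) [IsGaussian h] :
    ∃ (R : F →L[ℝ] E) (ρ : Measure E), IsGaussian ρ ∧
      h = (ρ.prod (h.map Prod.snd)).map fun z => (z.1 + R z.2, z.2) := by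
  have := FiniteDimensional.complete ℝ E
  have := FiniteDimensional.complete ℝ F
  have := FiniteDimensional.proper ℝ E
  have := FiniteDimensional.proper ℝ F
  obtain ⟨R, hR⟩ := exists_covariance_sub_clm_eq_zero (IsGaussian.memLp_two_id (μ := h))
  let A : E × F →L[ℝ] E × F := (ContinuousLinearMap.fst ℝ E F -
    R ∘L ContinuousLinearMap.snd ℝ E F).prod (ContinuousLinearMap.snd ℝ E F)
  have hlaw : HasGaussianLaw (fun z : E × F => (z.1 - R z.2, z.2)) h :=
    ⟨(inferInstance : IsGaussian (h.map A))⟩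
  have hindep := hlaw.indepFun_of_covariance_strongDual hR
  rw [indepFun_iff_map_prod_eq_prod_map_map (by fun_prop) (by fun_prop)] at hindep
  refine ⟨R, h.map fun z => z.1 - R z.2, hlaw.fst.isGaussian_map, ?_⟩
  change h = ((h.map fun z => z.1 - R z.2).prod (h.map fun z => z.2)).map _
  rw [← hindep, Measure.map_map (by fun_prop) (by fun_prop)]
  simp [Function.comp_def]

end Regression

section GaussianGluing

variable {ι F : Type*} [Finite ι] {E : ι → Type*}
  [∀ j, NormedAddCommGroup (E j)] [∀ j, NormedSpace ℝ (E j)] [∀ j, FiniteDimensional ℝ (E j)]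
  [∀ j, MeasurableSpace (E j)] [∀ j, BorelSpace (E j)]
  [NormedAddCommGroup F] [NormedSpace ℝ F] [FiniteDimensional ℝ F]
  [MeasurableSpace F] [BorelSpace F]

lemma exists_isGaussian_map_eq_of_map_snd_eq {h : ∀ j, Measure (E j × F)} {n : Measure F}
    (hh : ∀ j, IsGaussian (h j)) (hn : IsGaussian n) (hsnd : ∀ j, (h j).map Prod.snd = n) :
    ∃ γ : Measure (F × ∀ j, E j), IsGaussian γ ∧ ∀ j, γ.map (fun z => (z.2 j, z.1)) = h j := by
  cases nonempty_fintype ι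
  have := fun j => FiniteDimensional.complete ℝ (E j)
  have := fun j => FiniteDimensional.proper ℝ (E j)
  have := FiniteDimensional.complete ℝ F
  have := FiniteDimensional.proper ℝ F
  choose R ρ hρ heq using fun j => exists_eq_map_prod_of_isGaussian (h j)
  let A : F × (∀ j, E j) →L[ℝ] F × ∀ j, E j :=
    (ContinuousLinearMap.fst ℝ F _).prod <| ContinuousLinearMap.pi fun j =>
      ContinuousLinearMap.proj (R := ℝ) (φ := E) j ∘L ContinuousLinearMap.snd ℝ F _ +
        R j ∘L ContinuousLinearMap.fst ℝ F _
  refine ⟨(n.prod (Measure.pi ρ)).map A, inferInstance, fun j => ?_⟩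
  have hmap : (n.prod (Measure.pi ρ)).map (fun z => (z.2 j, z.1)) = (ρ j).prod n := by
    rw [← Measure.prod_swap, Measure.map_map (by fun_prop) measurable_swap]
    conv_rhs => rw [← (measurePreserving_eval ρ j).map_eq, ← Measure.map_id (μ := n)]
    exact (Measure.map_prod_map _ _ (measurable_pi_apply j) measurable_id).symm
  rw [Measure.map_map (by fun_prop) (by fun_prop), heq j, hsnd j, ← hmap,
    Measure.map_map (by fun_prop) (by fun_prop)]
  rfl

end GaussianGluing

section DiscreteGluing

lemma card_support_tsub_single_lt {α : Type*} {p : α →₀ ℝ≥0} {a : α} (ha : p a ≠ 0) :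
    (p - Finsupp.single a (p a)).support.card < p.support.card :=
  Finset.card_lt_card <| Finset.ssubset_iff_of_subset Finsupp.support_tsub |>.2
    ⟨a, Finsupp.mem_support_iff.2 ha, by simp⟩

variable {ι B : Type*} [Finite ι] [Nonempty ι] {A : ι → Type*}

lemma exists_mem_transportPolytope_of_mapDomain_eq (π : ∀ j, A j → B) (p : ∀ j, A j →₀ ℝ≥0)
    (Q : B →₀ ℝ≥0) (hp : ∀ j, (p j).mapDomain (π j) = Q) :
    ∃ q ∈ transportPolytope p, ∀ a ∈ q.support, ∃ b, ∀ j, π j (a j) = b := by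
  cases nonempty_fintype ι
  classical
  induction hn : ∑ j, (p j).support.card using Nat.strong_induction_on generalizing p Q with
  | _ n ih =>
  rcases eq_or_ne Q 0 with rfl | hQ
  · have hp₀ : ∀ j, p j = 0 := fun j => Finsupp.ext fun a =>
      nonpos_iff_eq_zero.1 ((le_mapDomain_apply (π j) (p j) a).trans_eq (by simp [hp j]))
    exact ⟨0, fun j => by simp [hp₀ j], by simp⟩
  obtain ⟨b, hb⟩ := Finsupp.support_nonempty_iff.2 hQ
  have hfiber : ∀ j, ∃ a, π j a = b ∧ p j a ≠ 0 := fun j => by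
    obtain ⟨a, ha, hab⟩ := Finset.mem_image.1 (Finsupp.mapDomain_support (hp j ▸ hb))
    exact ⟨a, hab, Finsupp.mem_support_iff.1 ha⟩
  choose a hab ha using hfiber
  obtain ⟨i, hi⟩ := Finite.exists_min fun j => p j (a j)
  -- Removing the smallest of the chosen masses from all marginals empties at least one atom.
  let p' : ∀ j, A j →₀ ℝ≥0 := fun j => p j - Finsupp.single (a j) (p i (a i))
  have hsplit : ∀ j, p' j + Finsupp.single (a j) (p i (a i)) = p j := fun j =>
    tsub_add_cancel_of_le (Finsupp.single_le_iff.2 (hi j))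
  have hp' : ∀ j, (p' j).mapDomain (π j) + Finsupp.single b (p i (a i)) = Q := fun j => by
    rw [← hp j, ← hsplit j, Finsupp.mapDomain_add, Finsupp.mapDomain_single, hab j]
  have hcard : ∑ j, (p' j).support.card < n := hn ▸ Finset.sum_lt_sum
    (fun j _ => Finset.card_le_card Finsupp.support_tsub)
    ⟨i, Finset.mem_univ i, card_support_tsub_single_lt (ha i)⟩
  obtain ⟨q, hq, hsupp⟩ := ih _ hcard p' _
    (fun j => add_right_cancel ((hp' j).trans (hp' i).symm)) rfl
  refine ⟨q + Finsupp.single a (p i (a i)), fun j => ?_, fun x hx => ?_⟩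
  · rw [Finsupp.mapDomain_add, Finsupp.mapDomain_single, hq j, hsplit j]
  · rcases Finset.mem_union.1 (Finsupp.support_add hx) with hx | hx
    · exact hsupp x hx
    · obtain rfl := Finset.mem_singleton.1 (Finsupp.support_single_subset hx)
      exact ⟨b, hab⟩

end DiscreteGluing

section MixtureGluing

variable {ι F : Type*} [Finite ι] [Nonempty ι] {E : ι → Type*}
  [∀ j, NormedAddCommGroup (E j)] [∀ j, NormedSpace ℝ (E j)] [∀ j, FiniteDimensional ℝ (E j)]
  [∀ j, MeasurableSpace (E j)] [∀ j, BorelSpace (E j)]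

section

variable [NormedAddCommGroup F] [NormedSpace ℝ F] [FiniteDimensional ℝ F]
  [MeasurableSpace F] [BorelSpace F]

theorem exists_mem_gmm_map_eq_of_map_snd_eq {γ : ∀ j, Measure (E j × F)} {ν : Measure F}
    (hγ : ∀ j, γ j ∈ gmm (E j × F)) (hsnd : ∀ j, (γ j).map Prod.snd = ν) :
    ∃ Γ ∈ gmm (F × ∀ j, E j), ∀ j, Γ.map (fun z => (z.2 j, z.1)) = γ j := by
  cases nonempty_fintype ι
  have := FiniteDimensional.complete ℝ F
  have := FiniteDimensional.proper ℝ F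
  have := fun j => FiniteDimensional.proper ℝ (E j)
  choose hprob p hp using fun j => mem_gmm_iff.1 (hγ j)
  let sndMap (j) := GaussianMeasure.map (ContinuousLinearMap.snd ℝ (E j) F)
  have hmarg (j) : mixture ((p j).mapDomain (sndMap j)) = ν := by
    rw [mixture_mapDomain_map, hp j]
    exact hsnd j
  let i := Classical.arbitrary ι
  obtain ⟨q, hq, hsupp⟩ := exists_mem_transportPolytope_of_mapDomain_eq sndMap p _
    fun j => mixture_injective ((hmarg j).trans (hmarg i).symm)
  have hglue : ∀ h : ∀ j, GaussianMeasure (E j × F), ∃ G : GaussianMeasure (F × ∀ j, E j),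
      h ∈ q.support → ∀ j, (G : Measure (F × ∀ j, E j)).map (fun z => (z.2 j, z.1)) = h j := by
    intro h
    by_cases hh : h ∈ q.support
    · obtain ⟨n, hn⟩ := hsupp h hh
      obtain ⟨G, hG, hGh⟩ := exists_isGaussian_map_eq_of_map_snd_eq (fun j => (h j).2) n.2
        fun j => congrArg Subtype.val (hn j)
      exact ⟨⟨G, hG⟩, fun _ => hGh⟩
    · exact ⟨⟨Measure.dirac 0, inferInstance⟩, fun hh' => absurd hh' hh⟩
  choose G hG using hglue
  let pairing (j) : F × (∀ j, E j) →L[ℝ] E j × F :=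
    (ContinuousLinearMap.proj (R := ℝ) (φ := E) j ∘L ContinuousLinearMap.snd ℝ F _).prod
      (ContinuousLinearMap.fst ℝ F _)
  have hΓ (j) : (mixture (q.mapDomain G)).map (fun z => (z.2 j, z.1)) = γ j := by
    change (mixture (q.mapDomain G)).map (pairing j) = γ j
    rw [← mixture_mapDomain_map, ← Finsupp.mapDomain_comp, ← hp j, ← hq j]
    exact congrArg mixture (Finsupp.mapDomain_congr fun h hh => Subtype.ext (hG h hh j))
  refine ⟨mixture (q.mapDomain G), mem_gmm_iff.2 ⟨?_, _, rfl⟩, hΓ⟩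
  rw [← Measure.isProbabilityMeasure_map_iff (f := fun z => (z.2 i, z.1)) (by fun_prop), hΓ i]
  exact hprob i

end

lemma gmmCouplings_nonempty {μ : ∀ j, Measure (E j)} (hμ : ∀ j, μ j ∈ gmm (E j)) :
    (gmmCouplings μ).Nonempty := by
  cases nonempty_fintype ι
  have hprob : ∀ j, IsProbabilityMeasure (μ j) := fun j => (mem_gmm_iff.1 (hμ j)).1
  obtain ⟨Γ, hΓ, hΓμ⟩ := exists_mem_gmm_map_eq_of_map_snd_eq (ν := Measure.dirac (0 : ℝ))
    (fun j => map_mem_gmm (hμ j) (ContinuousLinearMap.inl ℝ (E j) ℝ)) fun j => by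
      rw [Measure.map_map (by fun_prop) (by fun_prop)]
      change (μ j).map (fun _ => (0 : ℝ)) = _
      simp
  refine ⟨_, map_mem_gmm hΓ (ContinuousLinearMap.snd ℝ ℝ (∀ j, E j)), fun j => ?_⟩
  have hj := congrArg (Measure.map Prod.fst) (hΓμ j)
  rw [Measure.map_map (by fun_prop) (by fun_prop),
    Measure.map_map (by fun_prop) (by fun_prop)] at hj
  rw [Measure.map_map (by fun_prop) (by fun_prop)]
  exact hj.trans Measure.map_id

end MixtureGluing

/-! ### Barycenters -/

section LIntegral

lemma lintegral_ofReal_sum_mul {ι X : Type*} [Fintype ι] [MeasurableSpace X] (w : ι → ℝ≥0)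
    (m : Measure X) {f : ι → X → ℝ} (hf : ∀ j, Measurable (f j)) (hf₀ : ∀ j x, 0 ≤ f j x) :
    ∫⁻ x, ENNReal.ofReal (∑ j, (w j : ℝ) * f j x) ∂m =
      ∑ j, (w j : ℝ≥0∞) * ∫⁻ x, ENNReal.ofReal (f j x) ∂m := by
  have hpoint : ∀ x, ENNReal.ofReal (∑ j, (w j : ℝ) * f j x) =
      ∑ j, (w j : ℝ≥0∞) * ENNReal.ofReal (f j x) := fun x => by
    rw [ENNReal.ofReal_sum_of_nonneg fun j _ => mul_nonneg (NNReal.coe_nonneg _) (hf₀ j x)]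
    simp_rw [ENNReal.ofReal_mul (NNReal.coe_nonneg _), ENNReal.ofReal_coe_nnreal]
  simp_rw [hpoint]
  rw [lintegral_finsetSum _ fun j _ => (hf j).ennreal_ofReal.const_mul _]
  simp_rw [lintegral_const_mul _ (hf _).ennreal_ofReal]

lemma lintegral_sq_norm_ne_top_of_mem_gmm {E : Type*} [NormedAddCommGroup E] [NormedSpace ℝ E]
    [MeasurableSpace E] [BorelSpace E] [CompleteSpace E] [SecondCountableTopology E]
    {μ : Measure E} (hμ : μ ∈ gmm E) : ∫⁻ x, ENNReal.ofReal (‖x‖ ^ 2) ∂μ ≠ ∞ := by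
  obtain ⟨-, p, rfl⟩ := mem_gmm_iff.1 hμ
  rw [lintegral_mixture]
  refine ENNReal.sum_ne_top.2 fun g _ => ENNReal.mul_ne_top ENNReal.coe_ne_top ?_
  have hint : Integrable (fun x => ‖x‖ ^ 2) (g : Measure E) :=
    (IsGaussian.memLp_two_id (μ := (g : Measure E))).integrable_norm_pow two_ne_zero
  exact (hasFiniteIntegral_iff_ofReal (ae_of_all _ fun x => sq_nonneg _)).1 hint.2 |>.ne

end LIntegral

section Barycenter

open scoped RealInnerProductSpace

variable {d J : ℕ} (w : Fin J → ℝ≥0) (μ : Fin J → Measure (Eucl d))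

/-- The barycenter map as a continuous linear map. -/
def baryCLM : (Fin J → Eucl d) →L[ℝ] Eucl d :=
  ∑ j, (w j : ℝ) • ContinuousLinearMap.proj j

lemma coe_baryCLM : ⇑(baryCLM (d := d) w) = baryMap w := by
  ext x
  simp [baryCLM, baryMap]

lemma continuous_baryMap : Continuous (baryMap (d := d) w) :=
  coe_baryCLM (d := d) w ▸ (baryCLM w).continuous

lemma continuous_multiCost : Continuous (multiCost (d := d) w) := by
  have := continuous_baryMap (d := d) w
  unfold multiCost
  fun_prop

variable {w} in
lemma multiCost_le (hw : ∑ j, w j = 1) (x : Fin J → Eucl d) (y : Eucl d) :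
    multiCost w x ≤ ∑ j, (w j : ℝ) * ‖x j - y‖ ^ 2 := by
  have hw' : ∑ j, (w j : ℝ) = 1 := by exact_mod_cast hw
  have hcenter : ∑ j, (w j : ℝ) • (x j - baryMap w x) = 0 := by
    simp_rw [smul_sub, Finset.sum_sub_distrib, ← Finset.sum_smul, hw', one_smul]
    exact sub_self _
  have hexpand : ∀ j, (w j : ℝ) * ‖x j - y‖ ^ 2 = (w j : ℝ) * ‖x j - baryMap w x‖ ^ 2 +
      2 * ⟪(w j : ℝ) • (x j - baryMap w x), baryMap w x - y⟫ +
        (w j : ℝ) * ‖baryMap w x - y‖ ^ 2 := fun j => by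
    rw [← sub_add_sub_cancel (x j) (baryMap w x) y, norm_add_sq_real, real_inner_smul_left]
    ring
  calc multiCost w x ≤ multiCost w x + ‖baryMap w x - y‖ ^ 2 :=
        le_add_of_nonneg_right (sq_nonneg _)
    _ = ∑ j, (w j : ℝ) * ‖x j - y‖ ^ 2 := by
        simp_rw [hexpand, Finset.sum_add_distrib, ← Finset.mul_sum, ← sum_inner, hcenter,
          ← Finset.sum_mul, hw', inner_zero_left, mul_zero, add_zero, one_mul]
        rfl

lemma gmmMultiPlans_eq_gmmCouplings : gmmMultiPlans μ = gmmCouplings μ := by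
  ext γ
  exact ⟨fun h => ⟨h.2, h.1.2⟩, fun h => ⟨⟨(mem_gmm_iff.1 h.1).1, h.2⟩, h.1⟩⟩

variable {w μ}

lemma neZero_of_sum_eq_one (hw : ∑ j, w j = 1) : NeZero J :=
  ⟨by rintro rfl; simp at hw⟩

lemma exists_isOptimalMultiPlan [NeZero J] (w : Fin J → ℝ≥0) (hμ : ∀ j, μ j ∈ gmm (Eucl d)) :
    ∃ γ, IsOptimalMultiPlan w μ γ := by
  have hc : Continuous fun x : Fin J → Eucl d => ENNReal.ofReal (multiCost w x) :=
    ENNReal.continuous_ofReal.comp (continuous_multiCost w)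
  obtain ⟨γ, hγ, hmin⟩ := exists_isMinOn_lintegral_gmmCouplings (gmmCouplings_nonempty hμ) hc
  rw [← gmmMultiPlans_eq_gmmCouplings] at hγ hmin
  exact ⟨γ, hγ, hmin⟩

lemma IsOptimalMultiPlan.MMW2sq_eq {γ : Measure (Fin J → Eucl d)}
    (hγ : IsOptimalMultiPlan w μ γ) : MMW2sq w μ = planCost w γ :=
  le_antisymm (iInf₂_le γ hγ.1) (le_iInf₂ fun _ h => hγ.2 h)

lemma planCost_ne_top (hw : ∑ j, w j = 1) (hμ : ∀ j, μ j ∈ gmm (Eucl d))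
    {γ : Measure (Fin J → Eucl d)} (hγ : γ ∈ multiPlans μ) : planCost w γ ≠ ∞ := by
  have hbound : ∀ x : Fin J → Eucl d, multiCost w x ≤ ∑ j, (w j : ℝ) * ‖x j‖ ^ 2 := fun x => by
    simpa only [sub_zero] using multiCost_le hw x 0
  refine ne_top_of_le_ne_top ?_ (lintegral_mono fun x => ENNReal.ofReal_le_ofReal (hbound x))
  rw [lintegral_ofReal_sum_mul w γ (fun j => by fun_prop) fun j x => sq_nonneg _]
  refine ENNReal.sum_ne_top.2 fun j _ => ENNReal.mul_ne_top ENNReal.coe_ne_top ?_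
  have hj := lintegral_sq_norm_ne_top_of_mem_gmm (hμ j)
  rwa [← hγ.2 j, lintegral_map (by fun_prop) (by fun_prop)] at hj

lemma map_baryMap_mem_gmm {γ : Measure (Fin J → Eucl d)} (hγ : γ ∈ gmm (Fin J → Eucl d))
    (w : Fin J → ℝ≥0) : γ.map (baryMap w) ∈ gmm (Eucl d) :=
  coe_baryCLM (d := d) w ▸ map_mem_gmm hγ (baryCLM w)

lemma baryObjective_map_baryMap_le (w : Fin J → ℝ≥0) {γ : Measure (Fin J → Eucl d)}
    (hγ : γ ∈ gmmMultiPlans μ) : baryObjective w μ (γ.map (baryMap w)) ≤ planCost w γ := by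
  obtain ⟨⟨hprob, hmarg⟩, hgmm⟩ := hγ
  have hB := continuous_baryMap (d := d) w
  unfold planCost multiCost
  rw [lintegral_ofReal_sum_mul w γ (fun j => by fun_prop) fun j x => sq_nonneg _]
  refine Finset.sum_le_sum fun j _ => mul_le_mul_right ?_ _
  have hpair : γ.map (fun x => (x j, baryMap w x)) ∈
      plans (μ j) (γ.map (baryMap w)) ∩ gmm (Eucl d × Eucl d) := by
    refine ⟨⟨Measure.isProbabilityMeasure_map (by fun_prop), ?_, ?_⟩, ?_⟩
    · rw [Measure.map_map (by fun_prop) (by fun_prop)]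
      exact hmarg j
    · rw [Measure.map_map (by fun_prop) (by fun_prop)]
      rfl
    · rw [← coe_baryCLM]
      exact map_mem_gmm hgmm ((ContinuousLinearMap.proj j).prod (baryCLM w))
  refine (iInf₂_le _ hpair).trans_eq ?_
  rw [lintegral_map (by fun_prop) (by fun_prop)]

lemma MMW2sq_le_sum_of_mem_plans (hw : ∑ j, w j = 1) {ν : Measure (Eucl d)}
    {γ : Fin J → Measure (Eucl d × Eucl d)}
    (hγ : ∀ j, γ j ∈ plans (μ j) ν ∩ gmm (Eucl d × Eucl d)) :
    MMW2sq w μ ≤ ∑ j, (w j : ℝ≥0∞) * ∫⁻ y, ENNReal.ofReal (‖y.1 - y.2‖ ^ 2) ∂(γ j) := by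
  have := neZero_of_sum_eq_one hw
  obtain ⟨Γ, hΓ, hΓγ⟩ :=
    exists_mem_gmm_map_eq_of_map_snd_eq (fun j => (hγ j).2) fun j => (hγ j).1.2.2
  have hplan : Γ.map Prod.snd ∈ gmmMultiPlans μ := by
    rw [gmmMultiPlans_eq_gmmCouplings]
    refine ⟨map_mem_gmm hΓ (ContinuousLinearMap.snd ℝ (Eucl d) (Fin J → Eucl d)), fun j => ?_⟩
    rw [← (hγ j).1.2.1, ← hΓγ j, Measure.map_map (by fun_prop) (by fun_prop),
      Measure.map_map (by fun_prop) (by fun_prop)]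
    rfl
  calc MMW2sq w μ ≤ planCost w (Γ.map Prod.snd) := iInf₂_le _ hplan
    _ = ∫⁻ z, ENNReal.ofReal (multiCost w z.2) ∂Γ :=
        lintegral_map (continuous_multiCost w).measurable.ennreal_ofReal measurable_snd
    _ ≤ ∫⁻ z, ENNReal.ofReal (∑ j, (w j : ℝ) * ‖z.2 j - z.1‖ ^ 2) ∂Γ :=
        lintegral_mono fun z => ENNReal.ofReal_le_ofReal (multiCost_le hw z.2 z.1)
    _ = ∑ j, (w j : ℝ≥0∞) * ∫⁻ z, ENNReal.ofReal (‖z.2 j - z.1‖ ^ 2) ∂Γ :=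
        lintegral_ofReal_sum_mul w Γ (fun j => by fun_prop) fun j z => sq_nonneg _
    _ = ∑ j, (w j : ℝ≥0∞) * ∫⁻ y, ENNReal.ofReal (‖y.1 - y.2‖ ^ 2) ∂(γ j) := by
        simp_rw [← hΓγ]
        refine Finset.sum_congr rfl fun j _ => ?_
        rw [lintegral_map (by fun_prop) (by fun_prop)]

lemma plans_inter_gmm_nonempty {μ ν : Measure (Eucl d)} (hμ : μ ∈ gmm (Eucl d))
    (hν : ν ∈ gmm (Eucl d)) : (plans μ ν ∩ gmm (Eucl d × Eucl d)).Nonempty := by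
  obtain ⟨γ, hγ, hmarg⟩ := gmmCouplings_nonempty (μ := ![μ, ν]) (Fin.forall_fin_two.2 ⟨hμ, hν⟩)
  have hmem := map_mem_gmm hγ ((ContinuousLinearMap.proj 0).prod (ContinuousLinearMap.proj 1) :
    (Fin 2 → Eucl d) →L[ℝ] Eucl d × Eucl d)
  refine ⟨_, ⟨(mem_gmm_iff.1 hmem).1, ?_, ?_⟩, hmem⟩
  · rw [Measure.map_map (by fun_prop) (by fun_prop)]
    exact hmarg 0
  · rw [Measure.map_map (by fun_prop) (by fun_prop)]
    exact hmarg 1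

lemma exists_mem_plans_lintegral_le_MW2sq_add {μ ν : Measure (Eucl d)} (hμ : μ ∈ gmm (Eucl d))
    (hν : ν ∈ gmm (Eucl d)) {ε : ℝ≥0∞} (hε : ε ≠ 0) :
    ∃ γ ∈ plans μ ν ∩ gmm (Eucl d × Eucl d),
      ∫⁻ y, ENNReal.ofReal (‖y.1 - y.2‖ ^ 2) ∂γ ≤ MW2sq μ ν + ε := by
  rcases eq_or_ne (MW2sq μ ν) ∞ with htop | htop
  · obtain ⟨γ, hγ⟩ := plans_inter_gmm_nonempty hμ hν
    exact ⟨γ, hγ, by simp [htop]⟩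
  · have hlt : MW2sq μ ν < MW2sq μ ν + ε := ENNReal.lt_add_right htop hε
    conv_lhs at hlt => unfold MW2sq
    simp only [iInf_lt_iff] at hlt
    obtain ⟨γ, hγ, hlt⟩ := hlt
    exact ⟨γ, hγ, hlt.le⟩

lemma MMW2sq_le_baryObjective (hw : ∑ j, w j = 1) (hμ : ∀ j, μ j ∈ gmm (Eucl d))
    {ν : Measure (Eucl d)} (hν : ν ∈ gmm (Eucl d)) : MMW2sq w μ ≤ baryObjective w μ ν := by
  refine ENNReal.le_of_forall_pos_le_add fun ε hε _ => ?_
  choose γ hγ hcost using fun j => exists_mem_plans_lintegral_le_MW2sq_add (hμ j) hν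
    (ENNReal.coe_ne_zero.2 hε.ne')
  calc MMW2sq w μ ≤ ∑ j, (w j : ℝ≥0∞) * ∫⁻ y, ENNReal.ofReal (‖y.1 - y.2‖ ^ 2) ∂(γ j) :=
        MMW2sq_le_sum_of_mem_plans hw hγ
    _ ≤ ∑ j, (w j : ℝ≥0∞) * (MW2sq (μ j) ν + ε) := by
        gcongr with j
        exact hcost j
    _ = baryObjective w μ ν + ε := by
        simp_rw [mul_add, Finset.sum_add_distrib, ← Finset.sum_mul]
        rw [show ∑ j, (w j : ℝ≥0∞) = 1 by exact_mod_cast hw, one_mul]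
        rfl

end Barycenter

end GMMOT

end

theorem mainTheorem5 {d J : ℕ} (w : Fin J → ℝ≥0) (hw : ∑ j, w j = 1)
    (μ : Fin J → Measure (GMMOT.Eucl d)) (hμ : ∀ j, μ j ∈ GMMOT.gmm (GMMOT.Eucl d)) :
    (∃ γ, GMMOT.IsOptimalMultiPlan w μ γ) ∧
    (∀ γ, GMMOT.IsOptimalMultiPlan w μ γ →
      GMMOT.IsMW2Barycenter w μ (γ.map (GMMOT.baryMap w))) ∧
    (⨅ ν ∈ GMMOT.gmm (GMMOT.Eucl d), GMMOT.baryObjective w μ ν) = GMMOT.MMW2sq w μ ∧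
    GMMOT.MMW2sq w μ ≠ ∞ := by
  have := GMMOT.neZero_of_sum_eq_one hw
  have hlower : ∀ ν ∈ GMMOT.gmm (GMMOT.Eucl d),
      GMMOT.MMW2sq w μ ≤ GMMOT.baryObjective w μ ν :=
    fun ν => GMMOT.MMW2sq_le_baryObjective hw hμ
  have hmem : ∀ γ, GMMOT.IsOptimalMultiPlan w μ γ →
      γ.map (GMMOT.baryMap w) ∈ GMMOT.gmm (GMMOT.Eucl d) :=
    fun γ hγ => GMMOT.map_baryMap_mem_gmm hγ.1.2 w
  have hupper : ∀ γ, GMMOT.IsOptimalMultiPlan w μ γ →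
      GMMOT.baryObjective w μ (γ.map (GMMOT.baryMap w)) ≤ GMMOT.MMW2sq w μ :=
    fun γ hγ => (GMMOT.baryObjective_map_baryMap_le w hγ.1).trans_eq hγ.MMW2sq_eq.symm
  obtain ⟨γ, hγ⟩ := GMMOT.exists_isOptimalMultiPlan w hμ
  refine ⟨⟨γ, hγ⟩, fun γ' hγ' => ⟨hmem γ' hγ', fun ν hν => (hupper γ' hγ').trans (hlower ν hν)⟩,
    le_antisymm ((iInf₂_le _ (hmem γ hγ)).trans (hupper γ hγ)) (le_iInf₂ hlower), ?_⟩
  exact hγ.MMW2sq_eq ▸ GMMOT.planCost_ne_top hw hμ hγ.1.1
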